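/- Let $n\in\mathbb N$, let $A\ge 0$ be real, and let $U(t)=1$ if $t>A$ and $U(t)=0$ if $t\le A$. Let $X_1,\dots,X_n$ be independent random variables, where $X_j$ has the Poisson distribution with unknown parameter $\lambda_j>0$, and write $\mathbf X=(X_1,\dots,X_n)$, $\boldsymbol\lambda=(\lambda_1,\dots,\lambda_n)$. Then, under squared error loss, the estimator $$V(\mathbf X)=\sum_{j=1}^n U(X_j-1)\,X_j$$ is admissible for the random quantity $$S(\mathbf X,\boldsymbol\lambda)=\sum_{j=1}^n U(X_j)\,\lambda_j ;$$ that is, there is no function $\delta:\{0,1,2,\dots\}^n\to\mathbb R$ such that $$E_{\boldsymbol\lambda}\big(\delta(\mathbf X)-S(\mathbf X,\boldsymbol\lambda)\big)^2\le E_{\boldsymbol\lambda}\big(V(\mathbf X)-S(\mathbf X,\boldsymbol\lambda)\big)^2$$ for all $\boldsymbol\lambda\in(0,\infty)^n$, with strict inequality for some $\boldsymbol\lambda\in(0,\infty)^n$. -/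

import Mathlib

open MeasureTheory ProbabilityTheory
open scoped NNReal ENNReal

/-- The indicator function `U(t) = 1` if `t > A` and `U(t) = 0` if `t ≤ A`. -/
noncomputable def UInd (A t : ℝ) : ℝ :=
  open Classical in if A < t then 1 else 0

/-- The random quantity `S(x, l) = ∑ j, U(x j) * l j` to be estimated. -/
noncomputable def estimand (A : ℝ) {n : ℕ} (x : Fin n → ℕ) (l : Fin n → ℝ≥0) : ℝ :=
  ∑ j, UInd A (x j) * (l j : ℝ)

/-- The `U, V` estimator `V(x) = ∑ j, U(x j - 1) * x j`; the subtraction is in `ℝ`. -/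
noncomputable def VEst (A : ℝ) {n : ℕ} (x : Fin n → ℕ) : ℝ :=
  ∑ j, UInd A ((x j : ℝ) - 1) * (x j : ℝ)

/-- The squared error risk `E_θ (d(X) - S(X, θ))²` of the estimator `d(X)` at `θ`,
as an extended nonnegative real (it is `∞` when the expectation diverges). -/
noncomputable def sqRisk {Ω 𝓧 Θ : Type*} [MeasurableSpace Ω] (P : Θ → Measure Ω)
    (X : Ω → 𝓧) (S : 𝓧 → Θ → ℝ) (d : 𝓧 → ℝ) (θ : Θ) : ℝ≥0∞ :=
  ∫⁻ ω, ENNReal.ofReal ((d (X ω) - S (X ω) θ) ^ 2) ∂(P θ)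

/-- `d(X)` is admissible for `S(X, θ)` under squared error loss, with parameter space `Θ₀`: it is a
(measurable) estimator, and no estimator `d'(X)` has risk at most that of `d(X)` everywhere on `Θ₀`
and strictly smaller risk somewhere on `Θ₀`. -/
def IsAdmissible {Ω 𝓧 Θ : Type*} [MeasurableSpace Ω] [MeasurableSpace 𝓧] (Θ₀ : Set Θ)
    (P : Θ → Measure Ω) (X : Ω → 𝓧) (S : 𝓧 → Θ → ℝ) (d : 𝓧 → ℝ) : Prop :=
  Measurable d ∧
    ¬ ∃ d' : 𝓧 → ℝ, Measurable d' ∧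
      (∀ θ ∈ Θ₀, sqRisk P X S d' θ ≤ sqRisk P X S d θ) ∧
      ∃ θ ∈ Θ₀, sqRisk P X S d' θ < sqRisk P X S d θ

/-! Put `m = ⌊A⌋₊ + 1`: then `V` sums the `x j > m` and `S` sums the `l j` with `x j ≥ m`. If `d` is
nowhere worse than `V` and `g = d - V`, then `E (g ^ 2 + 2 g (V - S)) ≤ 0` at all rates. This forces
`g = 0` (`eq_zero_of_risk_le`), by induction on the dimension.

A coordinate with value `k ≤ m` adds nothing to `V` and at most its own rate to `S`. As that rate
tends to zero, the lowest nonzero slice `x i = k` of `g` inherits the inequality in the other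
coordinates (`tsum_slice_le_zero`), so it vanishes by induction. Hence `g` lives where every `x j >
m`, and there `V - S` is total count minus total rate.

On a ray only the total rate `t` varies, and a limiting Bayes argument applies. Integration against
`exp (-t / r) / t` gives `∑ b (N - 1)! r ^ N (g ^ 2 + 2 g N (1 - r)) ≤ 0`. As `∑ b N! r ^ N ≤ 1 / (1
- r)`, Cauchy–Schwarz bounds the cross term by a constant times the root of the quadratic one,
uniformly as `r → 1`; so `∑ b (N - 1)! g ^ 2` is finite. Its tail is then small, and on a finite set
the cross term dies with the factor `1 - r`; so the sum is zero (`eq_zero_of_risk_le_zero_on_ray`).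
-/

/-! ### Laplace integrals of power series -/

theorem integral_pow_mul_exp_neg_div (N : ℕ) {r : ℝ} (hr : 0 < r) :
    ∫ t in Set.Ioi (0 : ℝ), t ^ N * Real.exp (-(t / r)) = N.factorial * r ^ (N + 1) := by
  have h := Real.integral_rpow_mul_exp_neg_mul_Ioi (a := (N : ℝ) + 1) (r := 1 / r)
    (by positivity) (by positivity)
  rw [Real.Gamma_nat_eq_factorial] at h
  have e : (1 / (1 / r)) ^ ((N : ℝ) + 1) = r ^ (N + 1) := by
    rw [one_div_one_div]; exact_mod_cast Real.rpow_natCast r (N + 1)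
  rw [e, mul_comm] at h
  rw [← h]
  refine setIntegral_congr_fun measurableSet_Ioi fun t _ => ?_
  simp only [add_sub_cancel_right, Real.rpow_natCast]
  congr 2; ring

theorem integrableOn_pow_mul_exp_neg_div (N : ℕ) {r : ℝ} (hr : 0 < r) :
    IntegrableOn (fun t : ℝ => t ^ N * Real.exp (-(t / r))) (Set.Ioi 0) := by
  apply Integrable.of_integral_ne_zero
  rw [integral_pow_mul_exp_neg_div N hr]
  positivity

/-- A power series with nonnegative coefficients bounded by `C * exp (s * t)` has a convergent
Borel sum on the disc of radius `1 / s`. -/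
theorem summable_factorial_of_le_exp {ι : Type*} {b : ι → ℝ} (hb : ∀ x, 0 ≤ b x) {N : ι → ℕ}
    {C s r : ℝ} (hr : 0 < r) (hsr : s * r < 1)
    (h : ∀ t, 0 < t → Summable (fun x => b x * t ^ N x) ∧
      ∑' x, b x * t ^ N x ≤ C * Real.exp (s * t)) :
    Summable (fun x => b x * (N x).factorial * r ^ N x) ∧
      ∑' x, b x * (N x).factorial * r ^ N x ≤ C / (1 - s * r) := by
  have hd : 0 < 1 - s * r := by linarith
  have key : ∀ F : Finset ι, ∑ x ∈ F, b x * (N x).factorial * r ^ N x ≤ C / (1 - s * r) := by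
    intro F
    -- `exp (s t) exp (-t / r) = exp (-t / r')` with `r' = r / (1 - s r)`.
    have hr' : 0 < r / (1 - s * r) := by positivity
    have h1 : ∫ t in Set.Ioi (0 : ℝ), ∑ x ∈ F, b x * (t ^ N x * Real.exp (-(t / r)))
        = r * ∑ x ∈ F, b x * (N x).factorial * r ^ N x := by
      rw [integral_finsetSum _ fun x _ => (integrableOn_pow_mul_exp_neg_div (N x) hr).const_mul _,
        Finset.mul_sum]
      refine Finset.sum_congr rfl fun x _ => ?_
      rw [integral_const_mul, integral_pow_mul_exp_neg_div _ hr]; ring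
    have h2 : ∫ t in Set.Ioi (0 : ℝ), C * (t ^ 0 * Real.exp (-(t / (r / (1 - s * r)))))
        = r * (C / (1 - s * r)) := by
      rw [integral_const_mul, integral_pow_mul_exp_neg_div _ hr']; simp; ring
    have h3 : r * ∑ x ∈ F, b x * (N x).factorial * r ^ N x ≤ r * (C / (1 - s * r)) := by
      rw [← h1, ← h2]
      refine setIntegral_mono_on
        (integrable_finsetSum _ fun x _ => (integrableOn_pow_mul_exp_neg_div (N x) hr).const_mul _)
        ((integrableOn_pow_mul_exp_neg_div 0 hr').const_mul _) measurableSet_Ioi fun t ht => ?_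
      obtain ⟨hs, hle⟩ := h t ht
      have ht0 : (0 : ℝ) < t := ht
      have h4 : ∑ x ∈ F, b x * t ^ N x ≤ C * Real.exp (s * t) :=
        (hs.sum_le_tsum F fun x _ => mul_nonneg (hb x) (by positivity)).trans hle
      calc ∑ x ∈ F, b x * (t ^ N x * Real.exp (-(t / r)))
          = (∑ x ∈ F, b x * t ^ N x) * Real.exp (-(t / r)) := by
            rw [Finset.sum_mul]; exact Finset.sum_congr rfl fun x _ => by ring
        _ ≤ C * Real.exp (s * t) * Real.exp (-(t / r)) := by gcongr
        _ = C * (t ^ 0 * Real.exp (-(t / (r / (1 - s * r))))) := by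
            rw [mul_assoc, ← Real.exp_add, pow_zero, one_mul]
            congr 2; field_simp; ring
    exact le_of_mul_le_mul_left h3 hr
  have hs : Summable (fun x => b x * (N x).factorial * r ^ N x) :=
    summable_of_sum_le (fun x => mul_nonneg (mul_nonneg (hb x) (by positivity)) (by positivity)) key
  exact ⟨hs, hs.tsum_le_of_sum_le key⟩

/-! ### The one-parameter problem on a ray -/

/-- Each of the `N` terms of the geometric sum is at least `q ^ N`. This trades a factor `N` for `1
/ (1 - q)`. -/
theorem natCast_mul_pow_mul_one_sub_le_one (N : ℕ) {q : ℝ} (h0 : 0 ≤ q) (h1 : q ≤ 1) :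
    N * q ^ N * (1 - q) ≤ 1 := by
  have h : (N : ℝ) * q ^ N ≤ ∑ k ∈ Finset.range N, q ^ k := by
    have := Finset.card_nsmul_le_sum (Finset.range N) (fun k => q ^ k) (q ^ N) fun k hk =>
      pow_le_pow_of_le_one h0 h1 (Finset.mem_range.1 hk).le
    simpa using this
  calc N * q ^ N * (1 - q) ≤ (∑ k ∈ Finset.range N, q ^ k) * (1 - q) :=
        mul_le_mul_of_nonneg_right h (by linarith)
    _ = 1 - q ^ N := by have := geom_sum_mul q N; linarith
    _ ≤ 1 := by have : 0 ≤ q ^ N := by positivity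
                linarith

/-- Integration of the risk inequality along a ray against `exp (-t / r) / t`. -/
theorem tsum_factorial_pred_le_zero {ι : Type*} [Countable ι] {b : ι → ℝ} (hb : ∀ x, 0 ≤ b x)
    {N : ι → ℕ} {g : ι → ℝ} (hN : ∀ x, g x ≠ 0 → 1 ≤ N x) {r : ℝ} (hr : 0 < r) (hr1 : r < 1)
    (hs1 : Summable fun x => b x * (N x).factorial * r ^ N x)
    (hs2 : Summable fun x => b x * (N x).factorial * r ^ N x * g x ^ 2)
    (hneg : ∀ t, 0 < t → ∑' x, b x * t ^ N x * (g x ^ 2 + 2 * g x * (N x - t)) ≤ 0) :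
    ∑' x, b x * (N x - 1).factorial * r ^ N x * (g x ^ 2 + 2 * g x * N x * (1 - r)) ≤ 0 := by
  -- The summand of `hneg` times `exp (-t / r) / t`. The truncated `N x - 1` is harmless: where `N x
  -- = 0`, also `g x = 0`.
  set f : ι → ℝ → ℝ := fun x t =>
    b x * (g x ^ 2 + 2 * g x * N x) * (t ^ (N x - 1) * Real.exp (-(t / r)))
      - 2 * b x * g x * (t ^ N x * Real.exp (-(t / r))) with hf
  have hfi : ∀ x, IntegrableOn (f x) (Set.Ioi 0) := fun x =>
    ((integrableOn_pow_mul_exp_neg_div _ hr).const_mul _).sub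
      ((integrableOn_pow_mul_exp_neg_div _ hr).const_mul _)
  have hfint : ∀ x, ∫ t in Set.Ioi (0 : ℝ), f x t
      = b x * (N x - 1).factorial * r ^ N x * (g x ^ 2 + 2 * g x * N x * (1 - r)) := by
    intro x
    rw [hf, integral_sub ((integrableOn_pow_mul_exp_neg_div _ hr).const_mul _)
      ((integrableOn_pow_mul_exp_neg_div _ hr).const_mul _), integral_const_mul,
      integral_const_mul, integral_pow_mul_exp_neg_div _ hr, integral_pow_mul_exp_neg_div _ hr]
    by_cases hg : g x = 0
    · simp [hg]
    · obtain ⟨k, hk⟩ := Nat.exists_eq_add_of_le' (hN x hg)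
      rw [hk, Nat.add_sub_cancel, Nat.factorial_succ]
      push_cast; ring
  have hnorm : Summable fun x => ∫ t in Set.Ioi (0 : ℝ), ‖f x t‖ := by
    refine Summable.of_nonneg_of_le (fun x => integral_nonneg fun t => norm_nonneg _)
      (fun x => ?_) ((hs2.mul_left 3).add (hs1.mul_left 2))
    by_cases hg : g x = 0
    · have := hb x
      have h0 : ∀ t, f x t = 0 := fun t => by simp [hf, hg]
      simp only [h0, norm_zero, integral_zero]
      positivity
    · have hle : ∫ t in Set.Ioi (0 : ℝ), ‖f x t‖ ≤ ∫ t in Set.Ioi (0 : ℝ),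
          (b x * (g x ^ 2 + 2 * |g x| * N x) * (t ^ (N x - 1) * Real.exp (-(t / r)))
            + 2 * b x * |g x| * (t ^ N x * Real.exp (-(t / r)))) := by
        refine setIntegral_mono_on (hfi x).norm
          (((integrableOn_pow_mul_exp_neg_div _ hr).const_mul _).add
            ((integrableOn_pow_mul_exp_neg_div _ hr).const_mul _)) measurableSet_Ioi fun t ht => ?_
        have ht0 : (0 : ℝ) < t := ht
        refine (norm_sub_le _ _).trans (add_le_add ?_ ?_)
        · rw [Real.norm_eq_abs, abs_mul, abs_mul, abs_of_nonneg (hb x),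
            abs_of_nonneg (a := t ^ _ * _) (by positivity)]
          have := hb x
          have h1 : |g x ^ 2 + 2 * g x * N x| ≤ g x ^ 2 + 2 * |g x| * N x := by
            refine (abs_add_le _ _).trans (le_of_eq ?_)
            simp [abs_mul]
          gcongr
        · rw [Real.norm_eq_abs, abs_mul, abs_of_nonneg (a := t ^ _ * _) (by positivity),
            abs_mul, abs_mul, abs_of_nonneg (hb x), abs_two]
      refine hle.trans ?_
      rw [integral_add ((integrableOn_pow_mul_exp_neg_div _ hr).const_mul _)
        ((integrableOn_pow_mul_exp_neg_div _ hr).const_mul _), integral_const_mul,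
        integral_const_mul, integral_pow_mul_exp_neg_div _ hr, integral_pow_mul_exp_neg_div _ hr]
      obtain ⟨k, hk⟩ := Nat.exists_eq_add_of_le' (hN x hg)
      rw [hk, Nat.add_sub_cancel, Nat.factorial_succ]
      push_cast
      have hbk : 0 ≤ b x * (k.factorial : ℝ) * r ^ (k + 1) := mul_nonneg
        (mul_nonneg (hb x) (by positivity)) (by positivity)
      have hk0 : (0 : ℝ) ≤ k := by positivity
      have ha := abs_nonneg (g x)
      have hsq : g x ^ 2 = |g x| ^ 2 := (sq_abs _).symm
      -- Uses `r < 1`, `4 |g| ≤ 2 g ^ 2 + 2` and `g ^ 2 ≤ (k + 1) g ^ 2`.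
      have h1 : g x ^ 2 + 2 * |g x| * (k + 1) + 2 * |g x| * ((k + 1) * r)
          ≤ (k + 1) * (3 * g x ^ 2 + 2) := by
        rw [hsq]
        have : (k + 1) * (2 * |g x| * r) ≤ (k + 1) * (2 * |g x|) := by
          apply mul_le_mul_of_nonneg_left _ (by positivity)
          nlinarith
        nlinarith [mul_nonneg hk0 (sq_nonneg (|g x| - 1)), mul_nonneg hk0 (sq_nonneg (|g x|)),
          sq_nonneg (|g x| - 1)]
      have := mul_le_mul_of_nonneg_left h1 hbk
      calc _ = b x * (k.factorial : ℝ) * r ^ (k + 1) *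
            (g x ^ 2 + 2 * |g x| * (k + 1) + 2 * |g x| * ((k + 1) * r)) := by ring
        _ ≤ _ := this
        _ = _ := by ring
  have hsum := hasSum_integral_of_summable_integral_norm hfi hnorm
  rw [← tsum_congr hfint, hsum.tsum_eq]
  refine setIntegral_nonpos measurableSet_Ioi fun t ht => ?_
  have ht0 : (0 : ℝ) < t := ht
  have : ∀ x, f x t = Real.exp (-(t / r)) / t *
      (b x * t ^ N x * (g x ^ 2 + 2 * g x * (N x - t))) := by
    intro x
    by_cases hg : g x = 0
    · simp [hf, hg]
    · obtain ⟨k, hk⟩ := Nat.exists_eq_add_of_le' (hN x hg)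
      simp only [hf, hk, Nat.add_sub_cancel]
      field_simp
      ring
  rw [tsum_congr this, tsum_mul_left]
  exact mul_nonpos_of_nonneg_of_nonpos (by positivity) (hneg t ht0)

/-- The quadratic estimate behind the limit `q → 1` in `eq_zero_of_risk_le_zero_on_ray`. -/
theorem tsum_sq_le_of_risk_le_zero_on_ray {ι : Type*} [Countable ι] {b : ι → ℝ}
    (hb : ∀ x, 0 ≤ b x) {N : ι → ℕ} {g : ι → ℝ} (hN : ∀ x, g x ≠ 0 → 1 ≤ N x)
    (hexp : ∀ t, 0 < t → HasSum (fun x => b x * t ^ N x) (Real.exp t))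
    (hgrow : ∀ s, 1 < s → ∃ C, ∀ t, 0 < t → Summable (fun x => b x * t ^ N x * g x ^ 2) ∧
      ∑' x, b x * t ^ N x * g x ^ 2 ≤ C * Real.exp (s * t))
    (hneg : ∀ t, 0 < t → ∑' x, b x * t ^ N x * (g x ^ 2 + 2 * g x * (N x - t)) ≤ 0)
    {q θ : ℝ} (hq : 0 < q) (hq1 : q < 1) (hθ : 0 < θ) (F : Finset ι) :
    Summable (fun x => b x * (N x - 1).factorial * g x ^ 2 * (q ^ 2) ^ N x) ∧
    ∑' x, b x * (N x - 1).factorial * g x ^ 2 * (q ^ 2) ^ N x ≤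
      (1 - q ^ 2) * ∑ x ∈ F, 2 * |g x| * (b x * (N x).factorial) +
      θ * (∑' x, b x * (N x - 1).factorial * g x ^ 2 * (q ^ 2) ^ N x -
        ∑ x ∈ F, b x * (N x - 1).factorial * g x ^ 2 * (q ^ 2) ^ N x) + 4 / θ := by
  classical
  -- Taking `r = q ^ 2` leaves two factors `q ^ N`: one absorbs an extra `N`, the other keeps the
  -- series convergent.
  have hr : 0 < q ^ 2 := by positivity
  have hr1 : q ^ 2 < 1 := by nlinarith
  have hexp' : ∀ t, 0 < t → Summable (fun x => b x * t ^ N x) ∧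
      ∑' x, b x * t ^ N x ≤ 1 * Real.exp (1 * t) := fun t ht => by
    rw [one_mul, one_mul]; exact ⟨(hexp t ht).summable, (hexp t ht).tsum_eq.le⟩
  obtain ⟨hs1, -⟩ := summable_factorial_of_le_exp hb hr (by linarith) hexp'
  obtain ⟨hsq, hsq'⟩ := summable_factorial_of_le_exp hb hq (by linarith) hexp'
  obtain ⟨s, hs, hsr⟩ : ∃ s : ℝ, 1 < s ∧ s * q ^ 2 < 1 := by
    -- Any `s` strictly between `1` and `1 / q ^ 2` would serve.
    refine ⟨1 / q, by rw [one_lt_div hq]; exact hq1, ?_⟩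
    field_simp; exact hq1
  obtain ⟨C, hC⟩ := hgrow s hs
  have hs2 : Summable fun x => b x * (N x).factorial * (q ^ 2) ^ N x * g x ^ 2 := by
    have := (summable_factorial_of_le_exp (b := fun x => b x * g x ^ 2) (N := N) (C := C)
      (fun x => mul_nonneg (hb x) (sq_nonneg _)) hr hsr (fun t ht => by
        have e : ∀ x, b x * g x ^ 2 * t ^ N x = b x * t ^ N x * g x ^ 2 := fun x => by ring
        simp only [e]; exact hC t ht)).1
    exact this.congr fun x => by ring
  have hmain := tsum_factorial_pred_le_zero hb hN hr hr1 hs1 hs2 hneg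
  set a : ι → ℝ := fun x => b x * (N x - 1).factorial * g x ^ 2 * (q ^ 2) ^ N x with ha
  set D := 1 - q ^ 2 with hD
  have hD0 : 0 < D := by linarith
  have ha0 : ∀ x, 0 ≤ a x := fun x => by have := hb x; positivity
  have hsa : Summable a := by
    refine Summable.of_nonneg_of_le ha0 (fun x => ?_) hs2
    have h1 : ((N x - 1).factorial : ℝ) ≤ (N x).factorial := by
      exact_mod_cast Nat.factorial_le (Nat.sub_le _ _)
    have := hb x
    calc a x = b x * (N x - 1).factorial * (q ^ 2) ^ N x * g x ^ 2 := by simp only [ha]; ring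
      _ ≤ _ := by gcongr
  refine ⟨hsa, ?_⟩
  set c : ι → ℝ := fun x => b x * (N x).factorial * (q ^ 2) ^ N x with hc
  have hc0 : ∀ x, 0 ≤ c x := fun x => by have := hb x; positivity
  have heq : ∀ x, b x * (N x - 1).factorial * (q ^ 2) ^ N x * (g x ^ 2 + 2 * g x * N x * D)
      = a x + 2 * D * (g x * c x) := by
    intro x
    by_cases hg : g x = 0
    · simp [ha, hg]
    · obtain ⟨k, hk⟩ := Nat.exists_eq_add_of_le' (hN x hg)
      simp only [ha, hc, hk, Nat.add_sub_cancel, Nat.factorial_succ]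
      push_cast; ring
  rw [tsum_congr heq] at hmain
  have hsgc : Summable fun x => g x * c x := by
    refine Summable.of_norm_bounded (hs1.add hs2) fun x => ?_
    rw [Real.norm_eq_abs, abs_mul, abs_of_nonneg (hc0 x)]
    have : |g x| ≤ 1 + g x ^ 2 := by
      rw [← sq_abs]; nlinarith [sq_nonneg (|g x| - 1), abs_nonneg (g x)]
    calc |g x| * c x ≤ (1 + g x ^ 2) * c x := mul_le_mul_of_nonneg_right this (hc0 x)
      _ = _ := by simp only [hc]; ring
  rw [hsa.tsum_add (hsgc.mul_left _)] at hmain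
  set M : ι → ℝ := fun x => 2 * |g x| * (b x * (N x).factorial) with hM
  have hM0 : ∀ x, 0 ≤ M x := fun x => by have := hb x; positivity
  -- Majorant of the cross term: on `F` the `θ * a x` cancel and leave the crude bound `D * M x`;
  -- off `F` it comes from a weighted AM-GM inequality.
  set B : ι → ℝ := fun x => (if x ∈ F then D * M x - θ * a x else 0) + θ * a x
    + (4 * (1 - q) / θ) * (b x * (N x).factorial * q ^ N x) with hB
  have hsF : Summable fun x => if x ∈ F then D * M x - θ * a x else 0 :=
    summable_of_ne_finset_zero (s := F) fun x hx => by simp [hx]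
  have hsB : Summable B := (hsF.add (hsa.mul_left θ)).add (hsq.mul_left _)
  have hpt : ∀ x, -(2 * D * (g x * c x)) ≤ B x := by
    intro x
    have hlast : 0 ≤ (4 * (1 - q) / θ) * (b x * (N x).factorial * q ^ N x) := by
      have h1 : 0 < 1 - q := by linarith
      have := hb x
      positivity
    by_cases hx : x ∈ F
    · simp only [hB, hx, if_true]
      have h1 : -(2 * D * (g x * c x)) ≤ D * M x := by
        have h2 : c x ≤ b x * (N x).factorial := by
          have : (q ^ 2) ^ N x ≤ 1 := pow_le_one₀ hr.le hr1.le
          exact mul_le_of_le_one_right (mul_nonneg (hb x) (by positivity)) this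
        calc -(2 * D * (g x * c x)) = 2 * D * (-g x * c x) := by ring
          _ ≤ 2 * D * (|g x| * (b x * (N x).factorial)) := by
            gcongr
            · exact hc0 x
            · exact neg_le_abs _
          _ = D * M x := by simp only [hM]; ring
      linarith
    · by_cases hg : g x = 0
      · simp only [hg, zero_mul, mul_zero, neg_zero]
        simp only [hB, hx, if_false]
        have := mul_nonneg hθ.le (ha0 x)
        linarith
      simp only [hB, hx, if_false, zero_add]
      obtain ⟨k, hk⟩ := Nat.exists_eq_add_of_le' (hN x hg)
      set w := b x * (k.factorial : ℝ) * (q ^ 2) ^ (k + 1) with hw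
      have hw0 : 0 ≤ w := by have := hb x; positivity
      have hax : a x = w * g x ^ 2 := by
        simp only [ha, hk, Nat.add_sub_cancel, hw]; ring
      have hcx : c x = w * (k + 1) := by
        simp only [hc, hk, hw, Nat.factorial_succ]; push_cast; ring
      -- `-2uv ≤ θ u ^ 2 + v ^ 2 / θ` with `u = g x` and `v = (k + 1) * D`.
      have h1 : -(2 * D * (g x * (k + 1))) ≤ θ * g x ^ 2 + ((k + 1) * D) ^ 2 / θ := by
        have : 0 ≤ (θ * g x + (k + 1) * D) ^ 2 / θ := by positivity
        have e : (θ * g x + (k + 1) * D) ^ 2 / θ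
          = θ * g x ^ 2 + ((k + 1) * D) ^ 2 / θ + 2 * D * (g x * (k + 1)) := by
          field_simp; ring
        linarith
      have h2 : w * (((k + 1) * D) ^ 2 / θ) ≤
          (4 * (1 - q) / θ) * (b x * (N x).factorial * q ^ N x) := by
        have h3 := natCast_mul_pow_mul_one_sub_le_one (k + 1) hq.le hq1.le
        push_cast at h3
        have h4 : D * (1 + q) ≤ 4 * (1 - q) := by
          have : D * (1 + q) = (1 - q) * (1 + q) ^ 2 := by simp only [hD]; ring
          nlinarith
        have hb' : 0 ≤ b x * ((k + 1).factorial : ℝ) * q ^ (k + 1) / θ := by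
          have := hb x; positivity
        calc w * (((k + 1) * D) ^ 2 / θ)
            = (b x * ((k + 1).factorial : ℝ) * q ^ (k + 1) / θ) *
              (((k + 1) * q ^ (k + 1) * (1 - q)) * (D * (1 + q))) := by
              simp only [hw, hD, Nat.factorial_succ]; push_cast; ring
          _ ≤ (b x * ((k + 1).factorial : ℝ) * q ^ (k + 1) / θ) * (1 * (4 * (1 - q))) := by
              gcongr
          _ = _ := by rw [hk]; ring
      calc -(2 * D * (g x * c x)) = w * -(2 * D * (g x * (k + 1))) := by rw [hcx]; ring
        _ ≤ w * (θ * g x ^ 2 + ((k + 1) * D) ^ 2 / θ) := mul_le_mul_of_nonneg_left h1 hw0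
        _ = θ * a x + w * (((k + 1) * D) ^ 2 / θ) := by rw [hax]; ring
        _ ≤ _ := by linarith
  have hle := (hsgc.mul_left (2 * D)).neg.tsum_le_tsum hpt hsB
  rw [tsum_neg] at hle
  have hBt : ∑' x, B x = (∑ x ∈ F, (D * M x - θ * a x)) + θ * ∑' x, a x
      + (4 * (1 - q) / θ) * ∑' x, b x * (N x).factorial * q ^ N x := by
    rw [(hsF.add (hsa.mul_left θ)).tsum_add (hsq.mul_left _), hsF.tsum_add (hsa.mul_left θ),
      tsum_mul_left, tsum_mul_left, tsum_eq_sum (s := F) (fun x hx => by simp [hx])]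
    congr 2
    exact Finset.sum_congr rfl fun x hx => by simp [hx]
  have hK : (4 * (1 - q) / θ) * ∑' x, b x * (N x).factorial * q ^ N x ≤ 4 / θ := by
    have h1 : 0 < 1 - q := by linarith
    rw [one_mul] at hsq'
    calc _ ≤ (4 * (1 - q) / θ) * (1 / (1 - q)) := by gcongr
      _ = 4 / θ := by field_simp
  rw [Finset.sum_sub_distrib, ← Finset.mul_sum, ← Finset.mul_sum] at hBt
  linarith

open Filter Topology in
/-- Along a ray `t ↦ t • p`, an estimator `|x| + g x` of the total rate `t` whose risk nowhere
exceeds that of `|x|` satisfies `g = 0`. -/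
theorem eq_zero_of_risk_le_zero_on_ray {ι : Type*} [Countable ι] {b : ι → ℝ}
    (hb : ∀ x, 0 < b x) {N : ι → ℕ} {g : ι → ℝ} (hN : ∀ x, g x ≠ 0 → 1 ≤ N x)
    (hexp : ∀ t, 0 < t → HasSum (fun x => b x * t ^ N x) (Real.exp t))
    (hgrow : ∀ s, 1 < s → ∃ C, ∀ t, 0 < t → Summable (fun x => b x * t ^ N x * g x ^ 2) ∧
      ∑' x, b x * t ^ N x * g x ^ 2 ≤ C * Real.exp (s * t))
    (hneg : ∀ t, 0 < t → ∑' x, b x * t ^ N x * (g x ^ 2 + 2 * g x * (N x - t)) ≤ 0) :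
    g = 0 := by
  classical
  have key := fun {q θ : ℝ} => tsum_sq_le_of_risk_le_zero_on_ray (q := q) (θ := θ)
    (fun x => (hb x).le) hN hexp hgrow hneg
  set h : ι → ℝ := fun x => b x * (N x - 1).factorial * g x ^ 2 with hh
  have hh0 : ∀ x, 0 ≤ h x := fun x => by have := hb x; positivity
  have hlim : ∀ F : Finset ι, Tendsto (fun q : ℝ => ∑ x ∈ F, h x * (q ^ 2) ^ N x) (𝓝[<] 1)
      (𝓝 (∑ x ∈ F, h x)) := fun F => by
    have : Continuous fun q : ℝ => ∑ x ∈ F, h x * (q ^ 2) ^ N x := by fun_prop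
    simpa using (this.tendsto 1).mono_left nhdsWithin_le_nhds
  have hev : ∀ᶠ q : ℝ in 𝓝[<] 1, 0 < q ∧ q < 1 :=
    Ioo_mem_nhdsLT (show (0 : ℝ) < 1 by norm_num)
  have hterm : ∀ {q : ℝ}, 0 < q → ∀ x, 0 ≤ h x * (q ^ 2) ^ N x := fun hq x => by
    have := hh0 x; positivity
  -- With `θ = 1 / 2` and empty exceptional set, the full sum `T` satisfies `T ≤ T / 2 + 8`.
  have hbdd : ∀ F : Finset ι, ∑ x ∈ F, h x ≤ 16 := fun F => by
    refine le_of_tendsto (hlim F) (hev.mono fun q hq => ?_)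
    obtain ⟨hs, hle⟩ := key hq.1 hq.2 (show (0 : ℝ) < 1 / 2 by norm_num) ∅
    have h1 := hs.sum_le_tsum F fun x _ => hterm hq.1 x
    simp only [Finset.sum_empty] at hle
    linarith
  have hsum : Summable h := summable_of_sum_le hh0 hbdd
  -- The order of limits matters: `q → 1` with `F` fixed removes the `F` term, then `F` exhausts `ι`
  -- and removes the tail; `θ → ∞` comes last.
  have hfin : ∀ x θ, 0 < θ → h x ≤ 4 / θ := by
    intro x θ hθ
    have h1 : ∀ F : Finset ι, h x ≤ θ * (∑' y, h y - ∑ y ∈ F, h y) + 4 / θ := by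
      intro F
      have hR : Tendsto (fun q : ℝ => (1 - q ^ 2) * ∑ y ∈ F, 2 * |g y| * (b y * (N y).factorial)
          + θ * (∑' y, h y - ∑ y ∈ F, h y) + 4 / θ) (𝓝[<] 1)
          (𝓝 (θ * (∑' y, h y - ∑ y ∈ F, h y) + 4 / θ)) := by
        have : Continuous fun q : ℝ =>
          (1 - q ^ 2) * ∑ y ∈ F, 2 * |g y| * (b y * (N y).factorial)
          + θ * (∑' y, h y - ∑ y ∈ F, h y) + 4 / θ := by fun_prop
        simpa using (this.tendsto 1).mono_left nhdsWithin_le_nhds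
      have hL : Tendsto (fun q : ℝ => h x * (q ^ 2) ^ N x) (𝓝[<] 1) (𝓝 (h x)) := by
        simpa using hlim {x}
      refine le_of_tendsto_of_tendsto hL hR (hev.mono fun q hq => ?_)
      obtain ⟨hs, hle⟩ := key hq.1 hq.2 hθ F
      have h2 := hs.le_tsum x fun y _ => hterm hq.1 y
      have h3 : ∑' y, h y * (q ^ 2) ^ N y - ∑ y ∈ F, h y * (q ^ 2) ^ N y
          ≤ ∑' y, h y - ∑ y ∈ F, h y := by
        rw [← hs.sum_add_tsum_compl (s := F), ← hsum.sum_add_tsum_compl (s := F),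
          add_sub_cancel_left, add_sub_cancel_left]
        refine (hs.subtype _).tsum_le_tsum (fun y => ?_) (hsum.subtype _)
        exact mul_le_of_le_one_right (hh0 _)
          (pow_le_one₀ (by positivity) (pow_le_one₀ hq.1.le hq.2.le))
      have h4 := mul_le_mul_of_nonneg_left h3 hθ.le
      linarith
    have h2 : Tendsto (fun F : Finset ι => θ * (∑' y, h y - ∑ y ∈ F, h y) + 4 / θ) atTop
        (𝓝 (θ * (∑' y, h y - ∑' y, h y) + 4 / θ)) :=
      ((hsum.hasSum.const_sub _).const_mul θ).add_const _
    simpa using ge_of_tendsto' h2 h1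
  funext x
  have h0 : h x ≤ 0 := by
    have : Tendsto (fun θ : ℝ => 4 / θ) atTop (𝓝 0) := tendsto_const_nhds.div_atTop tendsto_id
    exact ge_of_tendsto this ((eventually_gt_atTop 0).mono fun θ hθ => hfin x θ hθ)
  have h1 : 0 < b x * (N x - 1).factorial := mul_pos (hb x) (by positivity)
  have h2 : g x ^ 2 ≤ 0 := by
    by_contra hc
    exact absurd h0 (not_le.2 (mul_pos h1 (not_le.1 hc)))
  simpa using le_antisymm h2 (sq_nonneg _)

/-! ### Poisson weights and growth of the risk -/

/-- The unnormalized probability mass at `x` of independent Poisson variables with rates `l`. -/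
noncomputable def poissonWeight {n : ℕ} (l : Fin n → ℝ) (x : Fin n → ℕ) : ℝ :=
  ∏ j, l j ^ x j / (x j).factorial

/-- The sum of the coordinates of `x` exceeding `m`. -/
noncomputable def truncSum (m : ℕ) {n : ℕ} (x : Fin n → ℕ) : ℝ :=
  ∑ j, if m < x j then (x j : ℝ) else 0

/-- The sum of the rates `l j` with `m ≤ x j`. -/
noncomputable def truncRate (m : ℕ) {n : ℕ} (x : Fin n → ℕ) (l : Fin n → ℝ) : ℝ :=
  ∑ j, if m ≤ x j then l j else 0

section Weights

variable {n : ℕ}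

theorem poissonWeight_nonneg {l : Fin n → ℝ} (hl : ∀ j, 0 < l j) (x : Fin n → ℕ) :
    0 ≤ poissonWeight l x :=
  Finset.prod_nonneg fun j _ => by have := hl j; positivity

theorem poissonWeight_pos {l : Fin n → ℝ} (hl : ∀ j, 0 < l j) (x : Fin n → ℕ) :
    0 < poissonWeight l x :=
  Finset.prod_pos fun j _ => by have := hl j; positivity

theorem poissonWeight_insertNth (i : Fin (n + 1)) (t : ℝ) (l : Fin n → ℝ) (k : ℕ)
    (x : Fin n → ℕ) : poissonWeight (i.insertNth (α := fun _ => ℝ) t l)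
      (i.insertNth (α := fun _ => ℕ) k x) = t ^ k / k.factorial * poissonWeight l x := by
  simp [poissonWeight, Fin.prod_univ_succAbove _ i]

theorem truncSum_insertNth (m : ℕ) (i : Fin (n + 1)) (k : ℕ) (x : Fin n → ℕ) :
    truncSum m (i.insertNth (α := fun _ => ℕ) k x) =
      (if m < k then (k : ℝ) else 0) + truncSum m x := by
  simp [truncSum, Fin.sum_univ_succAbove _ i]

theorem truncRate_insertNth (m : ℕ) (i : Fin (n + 1)) (k : ℕ) (x : Fin n → ℕ) (t : ℝ)
    (l : Fin n → ℝ) :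
    truncRate m (i.insertNth (α := fun _ => ℕ) k x) (i.insertNth (α := fun _ => ℝ) t l) =
      (if m ≤ k then t else 0) + truncRate m x l := by
  simp [truncRate, Fin.sum_univ_succAbove _ i]

theorem sum_insertNth_real (i : Fin (n + 1)) (t : ℝ) (l : Fin n → ℝ) :
    ∑ j, (i.insertNth (α := fun _ => ℝ) t l) j = t + ∑ j, l j := by
  simp [Fin.sum_univ_succAbove _ i]

theorem insertNth_pos (i : Fin (n + 1)) {t : ℝ} (ht : 0 < t) {l : Fin n → ℝ}
    (hl : ∀ j, 0 < l j) (j : Fin (n + 1)) : 0 < (i.insertNth (α := fun _ => ℝ) t l) j := by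
  induction j using Fin.succAboveCases i with
  | x => simpa
  | p j => simpa using hl j

theorem poissonWeight_mul (c : ℝ) (l : Fin n → ℝ) (x : Fin n → ℕ) :
    poissonWeight (fun j => c * l j) x = poissonWeight l x * c ^ (∑ j, x j) := by
  simp only [poissonWeight, mul_pow, ← Finset.prod_pow_eq_pow_sum, ← Finset.prod_mul_distrib]
  exact Finset.prod_congr rfl fun j _ => by ring

theorem hasSum_poissonWeight : ∀ {n : ℕ} {l : Fin n → ℝ}, (∀ j, 0 < l j) →
    HasSum (poissonWeight l) (Real.exp (∑ j, l j))
  | 0, l, _ => by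
    have := hasSum_unique (poissonWeight l)
    simpa [poissonWeight] using this
  | n + 1, l, hl => by
    have ih := hasSum_poissonWeight (l := fun j => l (Fin.succAbove 0 j)) fun j => hl _
    have h1 : HasSum (fun k : ℕ => l 0 ^ k / k.factorial) (Real.exp (l 0)) := by
      rw [Real.exp_eq_exp_ℝ]; exact NormedSpace.expSeries_div_hasSum_exp (l 0)
    have h0 := hl 0
    have hs := h1.summable.mul_of_nonneg ih.summable (fun k => by positivity)
      fun x => poissonWeight_nonneg (fun j => hl _) x
    have h2 := h1.mul ih hs
    rw [← (Fin.insertNthEquiv (fun _ => ℕ) (0 : Fin (n + 1))).hasSum_iff,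
      Fin.sum_univ_succAbove _ 0, Real.exp_add]
    refine h2.congr_fun fun p => ?_
    have := poissonWeight_insertNth 0 (l 0) (Fin.removeNth 0 l) p.1 p.2
    rwa [Fin.insertNth_self_removeNth] at this

theorem truncSum_nonneg (m : ℕ) (x : Fin n → ℕ) : 0 ≤ truncSum m x :=
  Finset.sum_nonneg fun j _ => by split_ifs <;> positivity

theorem truncSum_le (m : ℕ) (x : Fin n → ℕ) : truncSum m x ≤ ((∑ j, x j : ℕ) : ℝ) := by
  push_cast
  exact Finset.sum_le_sum fun j _ => by split_ifs <;> simp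

theorem truncRate_nonneg (m : ℕ) (x : Fin n → ℕ) {l : Fin n → ℝ} (hl : ∀ j, 0 < l j) :
    0 ≤ truncRate m x l :=
  Finset.sum_nonneg fun j _ => by split_ifs; exacts [(hl j).le, le_rfl]

theorem truncRate_le (m : ℕ) (x : Fin n → ℕ) {l : Fin n → ℝ} (hl : ∀ j, 0 < l j) :
    truncRate m x l ≤ ∑ j, l j :=
  Finset.sum_le_sum fun j _ => by split_ifs; exacts [le_rfl, (hl j).le]

/-- Both terms are nonnegative, so the cross term of the square can be dropped. -/
theorem sq_truncSum_sub_truncRate_le (m : ℕ) (x : Fin n → ℕ) {l : Fin n → ℝ}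
    (hl : ∀ j, 0 < l j) :
    (truncSum m x - truncRate m x l) ^ 2 ≤ ((∑ j, x j : ℕ) : ℝ) ^ 2 + (∑ j, l j) ^ 2 := by
  have h1 := truncSum_nonneg m x
  have h2 := truncSum_le m x
  have h3 := truncRate_nonneg m x hl
  have h4 := truncRate_le m x hl
  nlinarith [mul_nonneg h1 h3]

theorem sq_le_mul_exp {σ y : ℝ} (hσ : 0 < σ) (hy : 0 ≤ y) :
    y ^ 2 ≤ 2 / σ ^ 2 * Real.exp (σ * y) := by
  have h := Real.quadratic_le_exp_of_nonneg (mul_nonneg hσ.le hy)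
  have h0 := mul_nonneg hσ.le hy
  have h1 : σ ^ 2 * y ^ 2 ≤ 2 * Real.exp (σ * y) := by nlinarith
  rw [div_mul_eq_mul_div, le_div_iff₀ (by positivity)]
  linarith

/-- The second moment of the total count is subexponential in the total rate, after removing the
factor `exp (∑ j, l j)`. -/
theorem summable_poissonWeight_mul_sq {s : ℝ} (hs : 1 < s) {l : Fin n → ℝ} (hl : ∀ j, 0 < l j) :
    Summable (fun x => poissonWeight l x * ((∑ j, x j : ℕ) : ℝ) ^ 2) ∧
      ∑' x, poissonWeight l x * ((∑ j, x j : ℕ) : ℝ) ^ 2 ≤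
        2 / Real.log s ^ 2 * Real.exp (s * ∑ j, l j) := by
  have hs0 : 0 < s := by linarith
  have hσ := Real.log_pos hs
  have hsum := (hasSum_poissonWeight (l := fun j => s * l j) fun j => mul_pos hs0 (hl j)).mul_left
    (2 / Real.log s ^ 2)
  rw [← Finset.mul_sum] at hsum
  have hle : ∀ x, poissonWeight l x * ((∑ j, x j : ℕ) : ℝ) ^ 2 ≤
      2 / Real.log s ^ 2 * poissonWeight (fun j => s * l j) x := fun x => by
    -- With `σ = log s` the exponential is `s ^ |x|`, which the weight absorbs by scaling every rate
    -- by `s`.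
    have h1 := sq_le_mul_exp hσ (Nat.cast_nonneg (α := ℝ) (∑ j, x j))
    rw [mul_comm (Real.log s), Real.exp_nat_mul, Real.exp_log hs0] at h1
    rw [poissonWeight_mul]
    calc _ ≤ poissonWeight l x * (2 / Real.log s ^ 2 * s ^ (∑ j, x j)) :=
          mul_le_mul_of_nonneg_left h1 (poissonWeight_nonneg hl x)
      _ = _ := by ring
  have hsm := Summable.of_nonneg_of_le
    (fun x => mul_nonneg (poissonWeight_nonneg hl x) (sq_nonneg _)) hle hsum.summable
  exact ⟨hsm, (hsm.tsum_le_tsum hle hsum.summable).trans hsum.tsum_eq.le⟩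

/-- Makes the risk of `V` finite, with growth slow enough that the factorial series on a ray
converge for every `r < 1`. -/
theorem summable_poissonWeight_mul_sq_sub (m : ℕ) {s : ℝ} (hs : 1 < s) :
    ∃ C, ∀ l : Fin n → ℝ, (∀ j, 0 < l j) →
      Summable (fun x => poissonWeight l x * (truncSum m x - truncRate m x l) ^ 2) ∧
      ∑' x, poissonWeight l x * (truncSum m x - truncRate m x l) ^ 2 ≤
        C * Real.exp (s * ∑ j, l j) := by
  refine ⟨2 / Real.log s ^ 2 + 2 / (s - 1) ^ 2, fun l hl => ?_⟩
  obtain ⟨h1, h2⟩ := summable_poissonWeight_mul_sq hs hl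
  have h3 := (hasSum_poissonWeight hl).mul_right ((∑ j, l j) ^ 2)
  have hle : ∀ x, poissonWeight l x * (truncSum m x - truncRate m x l) ^ 2 ≤
      poissonWeight l x * ((∑ j, x j : ℕ) : ℝ) ^ 2 + poissonWeight l x * (∑ j, l j) ^ 2 :=
    fun x => by
      rw [← mul_add]
      exact mul_le_mul_of_nonneg_left (sq_truncSum_sub_truncRate_le m x hl)
        (poissonWeight_nonneg hl x)
  have hsm := Summable.of_nonneg_of_le
    (fun x => mul_nonneg (poissonWeight_nonneg hl x) (sq_nonneg _)) hle (h1.add h3.summable)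
  refine ⟨hsm, (hsm.tsum_le_tsum hle (h1.add h3.summable)).trans ?_⟩
  rw [h1.tsum_add h3.summable, h3.tsum_eq, add_mul]
  refine add_le_add h2 ?_
  have h4 := sq_le_mul_exp (sub_pos.2 hs) (Finset.sum_nonneg fun j (_ : j ∈ Finset.univ) =>
    (hl j).le)
  calc _ ≤ Real.exp (∑ j, l j) * (2 / (s - 1) ^ 2 * Real.exp ((s - 1) * ∑ j, l j)) := by gcongr
    _ = 2 / (s - 1) ^ 2 * (Real.exp (∑ j, l j) * Real.exp ((s - 1) * ∑ j, l j)) := by ring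
    _ = _ := by rw [← Real.exp_add]; congr 2; ring

end Weights

/-! ### Removing small coordinates; induction on the dimension -/

open Filter Topology in
/-- Letting one rate tend to zero: the first nonvanishing slice `x i = k` of `g`, if `k ≤ m`,
satisfies the risk inequality in the remaining coordinates. -/
theorem tsum_slice_le_zero {n m : ℕ} {g : (Fin (n + 1) → ℕ) → ℝ}
    (hsm : ∀ l : Fin (n + 1) → ℝ, (∀ j, 0 < l j) →
      Summable fun x => poissonWeight l x * g x ^ 2)
    (hneg : ∀ l : Fin (n + 1) → ℝ, (∀ j, 0 < l j) → ∑' x, poissonWeight l x *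
      (g x ^ 2 + 2 * g x * (truncSum m x - truncRate m x l)) ≤ 0)
    (i : Fin (n + 1)) {k : ℕ} (hk : k ≤ m)
    (hlt : ∀ k' < k, ∀ x, g (i.insertNth (α := fun _ => ℕ) k' x) = 0)
    {l : Fin n → ℝ} (hl : ∀ j, 0 < l j) :
    ∑' x, poissonWeight l x * (g (i.insertNth (α := fun _ => ℕ) k x) ^ 2 +
      2 * g (i.insertNth (α := fun _ => ℕ) k x) * (truncSum m x - truncRate m x l)) ≤ 0 := by
  set e := Fin.insertNthEquiv (fun _ => ℕ) i
  have he : ∀ p, e p = i.insertNth (α := fun _ => ℕ) p.1 p.2 := fun p => rfl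
  set lt : ℝ → Fin (n + 1) → ℝ := fun t => i.insertNth (α := fun _ => ℝ) t l with hlt_def
  have hltpos : ∀ t, 0 < t → ∀ j, 0 < lt t j := fun t ht => insertNth_pos i ht hl
  -- After division by `t ^ k`, slices below `k` are zero by hypothesis, slice `k` survives as `t →
  -- 0`, and higher slices keep a positive power of `t`.
  set f : ℝ → ℕ × (Fin n → ℕ) → ℝ := fun t p => (t ^ k)⁻¹ * (poissonWeight (lt t) (e p) *
    (g (e p) ^ 2 + 2 * g (e p) * (truncSum m (e p) - truncRate m (e p) (lt t)))) with hf
  set f₀ : ℕ × (Fin n → ℕ) → ℝ := fun p => if p.1 = k then (k.factorial : ℝ)⁻¹ *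
    (poissonWeight l p.2 * (g (e p) ^ 2 + 2 * g (e p) * (truncSum m p.2 - truncRate m p.2 l)))
    else 0 with hf₀
  have hfneg : ∀ t, 0 < t → ∑' p, f t p ≤ 0 := fun t ht => by
    rw [tsum_mul_left, e.tsum_eq (fun x => poissonWeight (lt t) x *
      (g x ^ 2 + 2 * g x * (truncSum m x - truncRate m x (lt t))))]
    exact mul_nonpos_of_nonneg_of_nonpos (by positivity) (hneg _ (hltpos t ht))
  have hf1 : ∀ t, 0 < t → ∀ p, k ≤ p.1 → f t p = t ^ (p.1 - k) * ((p.1.factorial : ℝ)⁻¹ *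
      (poissonWeight l p.2 *
      (g (e p) ^ 2 + 2 * g (e p) * (truncSum m (e p) - truncRate m (e p) (lt t))))) := by
    intro t ht p hp
    simp only [hf, he, hlt_def, poissonWeight_insertNth]
    obtain ⟨d, hd⟩ := Nat.exists_eq_add_of_le hp
    rw [hd, Nat.add_sub_cancel_left, pow_add]
    field_simp
  have hf2 : ∀ t p, p.1 < k → f t p = 0 := fun t p hp => by
    simp only [hf, he, hlt p.1 hp]; simp
  -- Dominating function for `0 < t < 1`: the weight and total rate at `t = 1`, with `|2 g v| ≤ g ^
  -- 2 + v ^ 2`.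
  set bd : ℕ × (Fin n → ℕ) → ℝ := fun p => poissonWeight (lt 1) (e p) * (2 * g (e p) ^ 2 +
    (((∑ j, e p j : ℕ) : ℝ) ^ 2 + (∑ j, lt 1 j) ^ 2)) with hbd
  have hbd0 : ∀ p, 0 ≤ bd p := fun p =>
    mul_nonneg (poissonWeight_nonneg (hltpos 1 one_pos) _) (by positivity)
  have hbds : Summable bd := by
    have h1 := (hsm _ (hltpos 1 one_pos)).mul_left 2
    have h2 := (summable_poissonWeight_mul_sq one_lt_two (hltpos 1 one_pos)).1
    have h3 := (hasSum_poissonWeight (hltpos 1 one_pos)).summable.mul_right ((∑ j, lt 1 j) ^ 2)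
    have h4 := e.summable_iff.2 (h1.add (h2.add h3))
    exact h4.congr fun p => by simp only [hbd, Function.comp]; ring
  have hbound : ∀ᶠ t : ℝ in 𝓝[>] 0, ∀ p, ‖f t p‖ ≤ bd p := by
    filter_upwards [Ioo_mem_nhdsGT (show (0 : ℝ) < 1 by norm_num)] with t ht p
    rcases lt_or_ge p.1 k with hp | hp
    · rw [hf2 t p hp, norm_zero]; exact hbd0 p
    · have hw : poissonWeight (lt 1) (e p) = (p.1.factorial : ℝ)⁻¹ * poissonWeight l p.2 := by
        simp only [he, hlt_def, poissonWeight_insertNth]; simp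
      have hw0 := poissonWeight_nonneg hl p.2
      simp only [hbd]
      rw [hf1 t ht.1 p hp, Real.norm_eq_abs, abs_mul, ← mul_assoc, abs_mul, hw,
        abs_of_nonneg (a := t ^ _) (pow_nonneg ht.1.le _),
        abs_of_nonneg (a := (_ : ℝ)⁻¹ * _) (by positivity)]
      have h1 : t ^ (p.1 - k) ≤ 1 := pow_le_one₀ ht.1.le ht.2.le
      have h2 : (∑ j, lt t j) ^ 2 ≤ (∑ j, lt 1 j) ^ 2 := by
        have h3 : 0 ≤ ∑ j, l j := Finset.sum_nonneg fun j _ => (hl j).le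
        simp only [hlt_def, sum_insertNth_real]
        have := ht.1; have := ht.2
        gcongr
      have h3 := sq_truncSum_sub_truncRate_le m (e p) (hltpos t ht.1)
      have h4 : |g (e p) ^ 2 + 2 * g (e p) * (truncSum m (e p) - truncRate m (e p) (lt t))| ≤
          2 * g (e p) ^ 2 + (((∑ j, e p j : ℕ) : ℝ) ^ 2 + (∑ j, lt 1 j) ^ 2) := by
        rw [abs_le]
        constructor <;>
          nlinarith [sq_nonneg (g (e p) + (truncSum m (e p) - truncRate m (e p) (lt t))),
            sq_nonneg (g (e p) - (truncSum m (e p) - truncRate m (e p) (lt t))),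
            sq_nonneg (g (e p))]
      calc _ ≤ 1 * (((p.1.factorial : ℝ)⁻¹ * poissonWeight l p.2) * _) := by gcongr
        _ = _ := one_mul _
  have hlimit : ∀ p, Tendsto (fun t => f t p) (𝓝[>] 0) (𝓝 (f₀ p)) := by
    intro p
    rcases lt_or_ge p.1 k with hp | hp
    · have : f₀ p = 0 := by simp [hf₀, hp.ne]
      simp only [hf2 _ p hp, this, tendsto_const_nhds]
    · set c : ℝ → ℝ := fun t => t ^ (p.1 - k) * ((p.1.factorial : ℝ)⁻¹ *
        (poissonWeight l p.2 * (g (e p) ^ 2 + 2 * g (e p) *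
        (((if m < p.1 then (p.1 : ℝ) else 0) + truncSum m p.2)
          - ((if m ≤ p.1 then t else 0) + truncRate m p.2 l))))) with hc
      have hfc : ∀ t, 0 < t → f t p = c t := fun t ht => by
        rw [hf1 t ht p hp]
        simp only [hc, he, hlt_def, truncSum_insertNth, truncRate_insertNth]
      have hcont : Continuous c := by
        have : Continuous fun t : ℝ => if m ≤ p.1 then t else 0 := by
          split_ifs <;> fun_prop
        fun_prop
      have hc0 : c 0 = f₀ p := by
        by_cases h : p.1 = k
        -- Even at `k = m`, where `truncRate` counts coordinate `i` but `truncSum` does not, the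
        -- discrepancy is the rate `t`, now zero.
        · have : ¬ m < k := not_lt.2 hk
          simp [hc, hf₀, h, this]
        · have : p.1 - k ≠ 0 := by omega
          simp [hc, hf₀, h, this]
      rw [← hc0]
      refine ((hcont.tendsto 0).mono_left nhdsWithin_le_nhds).congr' ?_
      filter_upwards [self_mem_nhdsWithin] with t ht using (hfc t ht).symm
  have hT := tendsto_tsum_of_dominated_convergence hbds hlimit hbound
  have h0 : ∑' p, f₀ p ≤ 0 := le_of_tendsto hT (by
    filter_upwards [self_mem_nhdsWithin] with t ht using hfneg t ht)
  have hinj : Function.Injective fun x : Fin n → ℕ => (k, x) := fun x y h => by simpa using h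
  have hsupp : Function.support f₀ ⊆ Set.range fun x : Fin n → ℕ => (k, x) := by
    rintro ⟨a, x⟩ hp
    by_cases h : a = k
    · exact ⟨x, by simp [h]⟩
    · exact absurd (by simp [hf₀, h]) hp
  rw [← hinj.tsum_eq hsupp] at h0
  simp only [hf₀, if_true, he] at h0
  rw [tsum_mul_left] at h0
  exact nonpos_of_mul_nonpos_right h0 (by positivity)

/-- If the estimator `truncSum m + g` of `truncRate m` has risk nowhere exceeding that of
`truncSum m`, then `g = 0`. -/
theorem eq_zero_of_risk_le {m : ℕ} : ∀ {n : ℕ} {g : (Fin n → ℕ) → ℝ},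
    (∀ s, 1 < s → ∃ C, ∀ l : Fin n → ℝ, (∀ j, 0 < l j) →
      Summable (fun x => poissonWeight l x * g x ^ 2) ∧
      ∑' x, poissonWeight l x * g x ^ 2 ≤ C * Real.exp (s * ∑ j, l j)) →
    (∀ l : Fin n → ℝ, (∀ j, 0 < l j) → ∑' x, poissonWeight l x *
      (g x ^ 2 + 2 * g x * (truncSum m x - truncRate m x l)) ≤ 0) → g = 0
  | 0, g, _, hneg => by
    have h := hneg Fin.elim0 (fun j => j.elim0)
    funext x
    rw [tsum_eq_single x fun y hy => absurd (Subsingleton.elim y x) hy] at h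
    simp only [poissonWeight, truncSum, truncRate, Finset.univ_eq_empty, Finset.prod_empty,
      Finset.sum_empty, sub_self, mul_zero, add_zero, one_mul] at h
    exact pow_eq_zero_iff two_ne_zero |>.1 (le_antisymm h (sq_nonneg _))
  | n + 1, g, hgrow, hneg => by
    have hsm : ∀ l : Fin (n + 1) → ℝ, (∀ j, 0 < l j) →
        Summable fun x => poissonWeight l x * g x ^ 2 := fun l hl => by
      obtain ⟨C, hC⟩ := hgrow 2 one_lt_two
      exact (hC l hl).1
    have hslice : ∀ (i : Fin (n + 1)) (k : ℕ), k ≤ m → ∀ x : Fin n → ℕ,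
        g (i.insertNth (α := fun _ => ℕ) k x) = 0 := by
      intro i k
      induction k using Nat.strong_induction_on with
      | _ k ihk =>
      intro hk
      refine fun x => congrFun (eq_zero_of_risk_le (m := m)
        (g := fun x => g (i.insertNth (α := fun _ => ℕ) k x)) (fun s hs => ?_)
        fun l hl => tsum_slice_le_zero hsm hneg i hk
          (fun k' hk' => ihk k' hk' (hk'.le.trans hk)) hl) x
      obtain ⟨C, hC⟩ := hgrow s hs
      -- The inserted rate is `1`: the weight gains `1 / k!` and the total rate gains `1`.
      refine ⟨k.factorial * C * Real.exp s, fun l hl => ?_⟩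
      obtain ⟨h1, h2⟩ := hC _ (insertNth_pos i one_pos hl)
      have hinj : Function.Injective fun x : Fin n → ℕ => i.insertNth (α := fun _ => ℕ) k x :=
        Fin.insertNth_right_injective (α := fun _ => ℕ) (p := i) k
      have e : ∀ x : Fin n → ℕ, poissonWeight l x * g (i.insertNth (α := fun _ => ℕ) k x) ^ 2 =
          k.factorial * (poissonWeight (i.insertNth (α := fun _ => ℝ) 1 l)
          (i.insertNth (α := fun _ => ℕ) k x) * g (i.insertNth (α := fun _ => ℕ) k x) ^ 2) := by
        intro x
        rw [poissonWeight_insertNth]; field_simp; simp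
      have h3 := h1.comp_injective hinj
      refine ⟨(h3.mul_left _).congr fun x => (e x).symm, ?_⟩
      rw [tsum_congr e, tsum_mul_left, mul_assoc (k.factorial : ℝ), mul_assoc (k.factorial : ℝ)]
      refine mul_le_mul_of_nonneg_left ?_ (by positivity)
      refine (tsum_comp_le_tsum_of_inj h1 (fun x => mul_nonneg
        (poissonWeight_nonneg (insertNth_pos i one_pos hl) x) (sq_nonneg _)) hinj).trans
        (h2.trans (le_of_eq ?_))
      rw [sum_insertNth_real, mul_assoc, ← Real.exp_add]
      congr 2; ring
    have hsupp : ∀ x, g x ≠ 0 → ∀ j, m < x j := by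
      intro x hx j
      by_contra hj
      apply hx
      have := hslice j (x j) (not_lt.1 hj) (j.removeNth x)
      rwa [Fin.insertNth_self_removeNth] at this
    -- Any positive direction with coordinates summing to `1` would do; then `t` is the total rate.
    set p : Fin (n + 1) → ℝ := fun _ => 1 / ((n : ℝ) + 1) with hp
    have hp0 : ∀ j, 0 < p j := fun j => by simp only [hp]; positivity
    have hp1 : ∀ t : ℝ, ∑ j, t * p j = t := fun t => by
      simp only [hp, Finset.sum_const, Finset.card_univ, Fintype.card_fin, nsmul_eq_mul]
      push_cast; field_simp
    have htp : ∀ t : ℝ, 0 < t → ∀ j, 0 < t * p j := fun t ht j => mul_pos ht (hp0 j)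
    refine eq_zero_of_risk_le_zero_on_ray (b := poissonWeight p) (N := fun x => ∑ j, x j)
      (poissonWeight_pos hp0) (fun x hx => ?_) (fun t ht => ?_) (fun s hs => ?_) fun t ht => ?_
    · exact (Nat.succ_le_of_lt ((Nat.zero_le m).trans_lt (hsupp x hx 0))).trans
        (Finset.single_le_sum (f := x) (fun _ _ => Nat.zero_le _) (Finset.mem_univ 0))
    · have := hasSum_poissonWeight (htp t ht)
      rw [hp1] at this
      exact this.congr_fun fun x => (poissonWeight_mul t p x).symm
    · obtain ⟨C, hC⟩ := hgrow s hs
      refine ⟨C, fun t ht => ?_⟩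
      have := hC _ (htp t ht)
      rw [hp1] at this
      simpa only [poissonWeight_mul] using this
    · refine le_of_eq_of_le (tsum_congr fun x => ?_) (hneg _ (htp t ht))
      rw [poissonWeight_mul]
      by_cases hx : g x = 0
      · simp [hx]
      · have h1 := hsupp x hx
        have h2 : truncSum m x = ((∑ j, x j : ℕ) : ℝ) := by
          push_cast
          exact Finset.sum_congr rfl fun j _ => if_pos (h1 j)
        have h3 : truncRate m x (fun j => t * p j) = t := by
          rw [← hp1 t]
          exact Finset.sum_congr rfl fun j _ => by rw [if_pos (h1 j).le, hp1]
        rw [h2, h3]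

/-! ### From the probability model to series -/

theorem estimand_eq_truncRate {A : ℝ} (hA : 0 ≤ A) {n : ℕ} (x : Fin n → ℕ) (l : Fin n → ℝ≥0) :
    estimand A x l = truncRate (⌊A⌋₊ + 1) x fun j => (l j : ℝ) := by
  refine Finset.sum_congr rfl fun j _ => ?_
  have h : A < x j ↔ ⌊A⌋₊ + 1 ≤ x j := (Nat.floor_lt hA).symm
  by_cases hx : A < x j
  · simp [UInd, hx, h.1 hx]
  · simp [UInd, hx, mt h.2 hx]

/-- The shift by one in `U (x j - 1)` turns the weak threshold of the estimand into a strict one at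
the same integer. -/
theorem VEst_eq_truncSum {A : ℝ} (hA : 0 ≤ A) {n : ℕ} (x : Fin n → ℕ) :
    VEst A x = truncSum (⌊A⌋₊ + 1) x := by
  refine Finset.sum_congr rfl fun j _ => ?_
  have h : A < (x j : ℝ) - 1 ↔ ⌊A⌋₊ + 1 < x j := by
    rw [← Nat.floor_add_one hA, Nat.floor_lt (by positivity), lt_sub_iff_add_lt]
  by_cases hx : A < (x j : ℝ) - 1
  · simp [UInd, hx, h.1 hx]
  · simp [UInd, hx, mt h.2 hx]

theorem pi_poissonMeasure_singleton {n : ℕ} (l : Fin n → ℝ≥0) (x : Fin n → ℕ) :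
    Measure.pi (fun j => poissonMeasure (l j)) {x} =
      ENNReal.ofReal (Real.exp (-∑ j, (l j : ℝ)) * poissonWeight (fun j => (l j : ℝ)) x) := by
  rw [Measure.pi_singleton]
  simp only [poissonMeasure_singleton]
  rw [← ENNReal.ofReal_prod_of_nonneg fun j _ => by positivity, poissonWeight,
    ← Finset.sum_neg_distrib, Real.exp_sum, ← Finset.prod_mul_distrib]
  congr 1
  exact Finset.prod_congr rfl fun j _ => mul_div_assoc _ _ _

theorem sqRisk_eq_tsum {Ω : Type*} [MeasurableSpace Ω] {n : ℕ}
    {P : (Fin n → ℝ≥0) → Measure Ω} {X : Fin n → Ω → ℕ} (hX : ∀ j, Measurable (X j))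
    {l : Fin n → ℝ≥0} (hindep : iIndepFun X (P l))
    (hlaw : ∀ j, (P l).map (X j) = poissonMeasure (l j))
    (S : (Fin n → ℕ) → (Fin n → ℝ≥0) → ℝ) (d : (Fin n → ℕ) → ℝ) :
    sqRisk P (fun ω j => X j ω) S d l = ∑' x, ENNReal.ofReal (Real.exp (-∑ j, (l j : ℝ)) *
      (poissonWeight (fun j => (l j : ℝ)) x * (d x - S x l) ^ 2)) := by
  have := hindep.isProbabilityMeasure
  have hmap := (iIndepFun_iff_map_fun_eq_pi_map fun j => (hX j).aemeasurable).1 hindep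
  simp only [hlaw] at hmap
  have hm : Measurable fun ω j => X j ω := measurable_pi_lambda _ hX
  rw [sqRisk, ← lintegral_map (f := fun x => ENNReal.ofReal ((d x - S x l) ^ 2))
    (measurable_of_countable _) hm, hmap, lintegral_countable']
  refine tsum_congr fun x => ?_
  rw [pi_poissonMeasure_singleton, ← ENNReal.ofReal_mul (sq_nonneg _)]
  congr 1; ring

/-- Comparison of the risks of two estimators, the second one of finite risk, in real terms. -/
theorem summable_of_tsum_ofReal_le {ι : Type*} {c : ℝ} (hc : 0 < c) {u v : ι → ℝ}
    (hu : ∀ x, 0 ≤ u x) (hv : ∀ x, 0 ≤ v x) (hsv : Summable v)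
    (h : ∑' x, ENNReal.ofReal (c * u x) ≤ ∑' x, ENNReal.ofReal (c * v x)) :
    Summable u ∧ ∑' x, u x ≤ ∑' x, v x := by
  have hcu : ∀ x, 0 ≤ c * u x := fun x => mul_nonneg hc.le (hu x)
  have hcv : ∀ x, 0 ≤ c * v x := fun x => mul_nonneg hc.le (hv x)
  rw [← ENNReal.ofReal_tsum_of_nonneg hcv (hsv.mul_left c)] at h
  have hsu : Summable fun x => c * u x := by
    have := ENNReal.summable_toReal (ne_top_of_le_ne_top ENNReal.ofReal_ne_top h)
    exact this.congr fun x => ENNReal.toReal_ofReal (hcu x)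
  rw [← ENNReal.ofReal_tsum_of_nonneg hcu hsu, ENNReal.ofReal_le_ofReal_iff (tsum_nonneg hcv),
    tsum_mul_left, tsum_mul_left] at h
  exact ⟨(summable_mul_left_iff hc.ne').1 hsu, le_of_mul_le_mul_left h hc⟩

theorem theorem3p1 {Ω : Type*} [MeasurableSpace Ω] (n : ℕ) (A : ℝ) (hA : 0 ≤ A)
    (P : (Fin n → ℝ≥0) → Measure Ω) (X : Fin n → Ω → ℕ) (hX : ∀ j, Measurable (X j))
    (hindep : ∀ l : Fin n → ℝ≥0, (∀ j, 0 < l j) → iIndepFun X (P l))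
    (hlaw : ∀ l : Fin n → ℝ≥0, (∀ j, 0 < l j) →
      ∀ j, (P l).map (X j) = poissonMeasure (l j)) :
    IsAdmissible {l : Fin n → ℝ≥0 | ∀ j, 0 < l j} P (fun ω j => X j ω)
      (estimand A) (VEst A) := by
  refine ⟨measurable_of_countable _, ?_⟩
  rintro ⟨d, -, hle, l₀, -, hlt⟩
  set m := ⌊A⌋₊ + 1
  have hdom : ∀ l : Fin n → ℝ, (∀ j, 0 < l j) →
      Summable (fun x => poissonWeight l x * (d x - truncRate m x l) ^ 2) ∧
      ∑' x, poissonWeight l x * (d x - truncRate m x l) ^ 2 ≤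
        ∑' x, poissonWeight l x * (truncSum m x - truncRate m x l) ^ 2 := by
    intro l hl
    obtain ⟨C, hC⟩ := summable_poissonWeight_mul_sq_sub (n := n) m one_lt_two
    lift l to Fin n → ℝ≥0 using fun j => (hl j).le
    have hl' : ∀ j, 0 < l j := fun j => hl j
    have h := hle l hl'
    rw [sqRisk_eq_tsum hX (hindep l hl') (hlaw l hl'),
      sqRisk_eq_tsum hX (hindep l hl') (hlaw l hl')] at h
    simp only [estimand_eq_truncRate hA, VEst_eq_truncSum hA] at h
    exact summable_of_tsum_ofReal_le (Real.exp_pos _)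
      (fun x => mul_nonneg (poissonWeight_nonneg hl x) (sq_nonneg _))
      (fun x => mul_nonneg (poissonWeight_nonneg hl x) (sq_nonneg _)) (hC _ hl).1 h
  have hg : (fun x => d x - truncSum m x) = 0 := by
    refine eq_zero_of_risk_le (m := m) (fun s hs => ?_) fun l hl => ?_
    · obtain ⟨C, hC⟩ := summable_poissonWeight_mul_sq_sub (n := n) m hs
      -- `g ^ 2 ≤ 2 (d - S) ^ 2 + 2 (V - S) ^ 2`, and both risks are controlled by that of `V`.
      refine ⟨4 * C, fun l hl => ?_⟩
      obtain ⟨h1, h2⟩ := hdom l hl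
      obtain ⟨h3, h4⟩ := hC l hl
      have hpt : ∀ x, poissonWeight l x * (d x - truncSum m x) ^ 2 ≤
          2 * (poissonWeight l x * (d x - truncRate m x l) ^ 2) +
          2 * (poissonWeight l x * (truncSum m x - truncRate m x l) ^ 2) := fun x => by
        have h5 : (d x - truncSum m x) ^ 2 ≤ 2 * (d x - truncRate m x l) ^ 2 +
            2 * (truncSum m x - truncRate m x l) ^ 2 := by
          nlinarith [sq_nonneg ((d x - truncRate m x l) + (truncSum m x - truncRate m x l))]
        linarith [mul_le_mul_of_nonneg_left h5 (poissonWeight_nonneg hl x)]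
      have hs2 := (h1.mul_left 2).add (h3.mul_left 2)
      have hs1 := Summable.of_nonneg_of_le
        (fun x => mul_nonneg (poissonWeight_nonneg hl x) (sq_nonneg _)) hpt hs2
      refine ⟨hs1, (hs1.tsum_le_tsum hpt hs2).trans ?_⟩
      rw [(h1.mul_left 2).tsum_add (h3.mul_left 2), tsum_mul_left, tsum_mul_left]
      linarith
    · obtain ⟨C, hC⟩ := summable_poissonWeight_mul_sq_sub (n := n) m one_lt_two
      obtain ⟨h1, h2⟩ := hdom l hl
      have h3 := (hC l hl).1
      -- `(d - S) ^ 2 - (V - S) ^ 2 = g ^ 2 + 2 g (V - S)`.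
      rw [← sub_nonpos, ← h1.tsum_sub h3] at h2
      refine le_of_eq_of_le (tsum_congr fun x => ?_) h2
      ring
  have hd : d = VEst A := by
    funext x
    rw [VEst_eq_truncSum hA]
    exact sub_eq_zero.1 (congrFun hg x)
  exact hlt.ne (by rw [hd])
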